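/- Let $b,c,d$ be smooth real functions on $[0,2]$ and $\beta,\gamma$ real numbers with $b\ge\beta^2>0$ and $c-\tfrac12\|d\|_{L^\infty(1,2)}-\tfrac{1}{2\beta^2}\|b'\|_{L^\infty(0,2)}^2\ge\gamma>0$ on $[0,2]$. Then there is a constant $C>0$, depending only on $b,c,d,\beta,\gamma$, such that the following holds for every $\varepsilon>0$, all $f\in L^\infty(0,2)$ and $\Phi\in L^\infty(-1,0)$, and all real $\alpha_1,\alpha_2,\alpha_3,\beta_1,\beta_2,\beta_3,\delta_1,\delta_2$. Let $u_1\in W^{4,1}(0,1)$ and $u_2\in W^{4,1}(1,2)$ (that is, $u_i$ is $C^3$ up to the end points with $u_i'''$ absolutely continuous) satisfy, almost everywhere on the respective interval, $$\varepsilon^2u_1^{(4)}(x)-b(x)u_1''(x)+c(x)u_1(x)=f(x)-d(x)\Phi(x-1),\quad x\in(0,1),$$ $$\varepsilon^2u_2^{(4)}(x)-b(x)u_2''(x)+c(x)u_2(x)=f(x)-d(x)u_1(x-1),\quad x\in(1,2),$$ together with $$u_1(0)=\alpha_1,\quad u_1(1)=\alpha_2,\quad u_2(1)=\alpha_2+\delta_1,\quad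 u_2(2)=\alpha_3,$$ $$u_1'(0)=\beta_1,\quad u_1'(1)=\beta_2,\quad u_2'(1)=\beta_2+\delta_2,\quad u_2'(2)=\beta_3,$$ where $\alpha_2,\beta_2$ are such that $u_2''(1)=u_1''(1)$ and $u_2'''(1)=u_1'''(1)$ (one-sided derivatives). Then $u:=u_1\chi_{[0,1)}+u_2\chi_{[1,2]}$ belongs to $L^\infty(0,2)$ and $$\|u\|_{L^\infty(0,2)}\le C\left(\|f\|_{L^\infty(0,2)}+\|\Phi\|_{L^\infty(-1,0)} +|\alpha_1|+|\alpha_3|+|\delta_1|+|\delta_2|+|\beta_1|+|\beta_3|\right).$$ -/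

import Mathlib

open MeasureTheory Set
open scoped ENNReal ContDiff

/-- The norm of `L^∞(D)` with respect to Lebesgue measure (the essential supremum of `|g|`),
to be used for functions in `L^∞(D)`. -/
noncomputable def linftyNorm (D : Set ℝ) (g : ℝ → ℝ) : ℝ :=
  (eLpNorm g ∞ (volume.restrict D)).toReal

/-- `g ∈ L^∞(D)`. -/
def MemLinfty (D : Set ℝ) (g : ℝ → ℝ) : Prop :=
  MemLp g ∞ (volume.restrict D)

/-- The `k`-th derivative of a function on the closed interval `[l, r]`
(one-sided at the end points). -/
noncomputable def dOn (l r : ℝ) (k : ℕ) (v : ℝ → ℝ) : ℝ → ℝ :=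
  iteratedDerivWithin k v (Icc l r)

/-- The regularity of a strong (Carathéodory) solution of a 4th order equation on `[l, r]`:
`v` is three times continuously differentiable up to the end points and `v'''` is absolutely
continuous, i.e. `v ∈ W^{4,1}(l, r)`. The fourth derivative then exists almost everywhere. -/
def IsStrong4 (l r : ℝ) (v : ℝ → ℝ) : Prop :=
  ContDiffOn ℝ 3 v (Icc l r) ∧ AbsolutelyContinuousOnInterval (dOn l r 3 v) l r

/-- The standing assumptions on the coefficients: `b, c, d` are smooth on `[0, 2]`,
`b ≥ β² > 0` and `c - ‖d‖_{L^∞(1,2)} / 2 - ‖b'‖²_{L^∞(0,2)} / (2 β²) ≥ γ > 0`. -/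
structure CoeffAssumptions (b c d : ℝ → ℝ) (β γ : ℝ) : Prop where
  smooth_b : ContDiffOn ℝ ∞ b (Icc 0 2)
  smooth_c : ContDiffOn ℝ ∞ c (Icc 0 2)
  smooth_d : ContDiffOn ℝ ∞ d (Icc 0 2)
  beta_pos : 0 < β ^ 2
  le_b : ∀ x ∈ Icc (0 : ℝ) 2, β ^ 2 ≤ b x
  gamma_pos : 0 < γ
  le_c : ∀ x ∈ Icc (0 : ℝ) 2,
    γ ≤ c x - linftyNorm (Ioo 1 2) d / 2
      - linftyNorm (Ioo 0 2) (deriv b) ^ 2 / (2 * β ^ 2)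

/-- The split system: the 4th order equations on `(0,1)` (with the history `Φ` in the shift term)
and on `(1,2)` (with `u₁` in the shift term). -/
structure SplitSystem (ε : ℝ) (b c d f Φ u₁ u₂ : ℝ → ℝ) : Prop where
  reg₁ : IsStrong4 0 1 u₁
  reg₂ : IsStrong4 1 2 u₂
  eq₁ : ∀ᵐ x ∂(volume.restrict (Ioo (0 : ℝ) 1)),
    ε ^ 2 * dOn 0 1 4 u₁ x - b x * dOn 0 1 2 u₁ x + c x * u₁ x = f x - d x * Φ (x - 1)
  eq₂ : ∀ᵐ x ∂(volume.restrict (Ioo (1 : ℝ) 2)),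
    ε ^ 2 * dOn 1 2 4 u₂ x - b x * dOn 1 2 2 u₂ x + c x * u₂ x = f x - d x * u₁ (x - 1)

/-- The general conditions at `0`, `1` and `2`: Dirichlet data for values and first derivatives,
with jumps `δ₁`, `δ₂` of the value and of the first derivative at `1`. -/
structure GeneralConditions (α₁ α₂ α₃ β₁ β₂ β₃ δ₁ δ₂ : ℝ) (u₁ u₂ : ℝ → ℝ) : Prop where
  val₀ : u₁ 0 = α₁
  val₁_left : u₁ 1 = α₂
  val₁_right : u₂ 1 = α₂ + δ₁
  val₂ : u₂ 2 = α₃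
  der₀ : dOn 0 1 1 u₁ 0 = β₁
  der₁_left : dOn 0 1 1 u₁ 1 = β₂
  der₁_right : dOn 1 2 1 u₂ 1 = β₂ + δ₂
  der₂ : dOn 1 2 1 u₂ 2 = β₃

/-- The jump at `1` of the `k`-th derivative, `u₂^{(k)}(1⁺) - u₁^{(k)}(1⁻)`. -/
noncomputable def jumpAtOne (k : ℕ) (u₁ u₂ : ℝ → ℝ) : ℝ :=
  dOn 1 2 k u₂ 1 - dOn 0 1 k u₁ 1

/-- The function `u = u₁ χ_{[0,1)} + u₂ χ_{[1,2]}`. -/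
noncomputable def glue (u₁ u₂ : ℝ → ℝ) : ℝ → ℝ :=
  (Ico (0 : ℝ) 1).indicator u₁ + (Icc (1 : ℝ) 2).indicator u₂

/-! The proof is an energy estimate for `w = u - g`, where `g` lifts the data: affine on `[0,1]`,
from the value and slope at `0`, and a Hermite cubic on `[1,2]` that absorbs the jumps `δ₁`, `δ₂`.
Then `w` and `w'` match at `1`, so the unknown `α₂`, `β₂` never need a bound. Testing the equation
with `w` gives the flux `ε²(u'''w - u''w') - b w'w`. It vanishes at `0` and `2`, and is continuous
at `1` because it contains `u''`, `u'''` rather than `w''`, `w'''` (`energyFlux`). Young's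
inequality bounds its derivative (`energy_density_le`); the lower bound on `c` pays for the `b'`
term and leaves `-(D/2) w²` on each interval, where `D` is the norm of `d`. The delay term costs
exactly `D/2` times `∫ w²` over each interval, after a shift of the first one, so the two cancel.
What remains is `(s/2)‖w'‖² + (ε²/2)‖w''‖² ≤ (1 + ε²) N` with `s = β²`. Since `w` vanishes to first
order at `0` and at `2`, both norms control `sup |w|` (`IsStrong4.sq_sub_le`), and using one or the
other according to the size of `ε` makes the constant uniform (`sq_le_of_energy_bound`). -/

/-! ### Integral inequalities for absolutely continuous and `C¹` functions -/

section AbsolutelyContinuous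

/-- An absolutely continuous function grows at most by the integral of a continuous upper bound for
its almost everywhere derivative. -/
theorem AbsolutelyContinuousOnInterval.sub_le_integral {P P' h : ℝ → ℝ} {l r : ℝ} (hlr : l ≤ r)
    (hP : AbsolutelyContinuousOnInterval P l r) (hh : ContinuousOn h (Icc l r))
    (hP' : ∀ᵐ x ∂(volume.restrict (Ioo l r)), HasDerivAt P (P' x) x)
    (hle : ∀ᵐ x ∂(volume.restrict (Ioo l r)), P' x ≤ h x) :
    P r - P l ≤ ∫ x in l..r, h x := by
  rw [← hP.integral_deriv_eq_sub]
  refine intervalIntegral.integral_mono_ae_restrict hlr hP.intervalIntegrable_deriv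
    (hh.intervalIntegrable_of_Icc hlr) ?_
  rw [← restrict_Ioo_eq_restrict_Icc]
  filter_upwards [hP', hle] with x hx hx'
  rwa [hx.deriv]

/-- A `C¹` function on an interval of length one that vanishes at some point is bounded by the
`L²` norm of its derivative. -/
theorem sq_le_integral_sq_deriv {v v' : ℝ → ℝ} {l r a x : ℝ} (hlr : r = l + 1)
    (hv : ContinuousOn v (Icc l r)) (hv' : ContinuousOn v' (Icc l r))
    (hd : ∀ y ∈ Ioo l r, HasDerivAt v (v' y) y) (ha : a ∈ Icc l r) (hva : v a = 0)
    (hx : x ∈ Icc l r) : v x ^ 2 ≤ ∫ y in l..r, v' y ^ 2 := by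
  have hle : l ≤ r := by linarith
  have hsub : uIcc a x ⊆ Icc l r := uIcc_subset_Icc ha hx
  have hint : IntervalIntegrable v' volume a x := (hv'.mono hsub).intervalIntegrable
  have hftc : ∫ y in a..x, v' y = v x := by
    rw [intervalIntegral.integral_eq_sub_of_hasDeriv_right (hv.mono hsub) (fun y hy ↦ ?_) hint,
      hva, sub_zero]
    refine (hd y ⟨?_, ?_⟩).hasDerivWithinAt
    · exact (le_min ha.1 hx.1).trans_lt hy.1
    · exact hy.2.trans_le (max_le ha.2 hx.2)
  have hlr_int : IntervalIntegrable (fun y ↦ |v' y|) volume l r :=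
    hv'.abs.intervalIntegrable_of_Icc hle
  have habs : |v x| ≤ ∫ y in l..r, |v' y| := by
    rw [← hftc, ← abs_of_nonneg (intervalIntegral.integral_nonneg hle fun y _ ↦ abs_nonneg (v' y))]
    have hnorm := intervalIntegral.norm_integral_le_abs_integral_norm (f := v') (a := a) (b := x)
      (μ := volume)
    simp only [Real.norm_eq_abs] at hnorm
    refine hnorm.trans (intervalIntegral.abs_integral_mono_interval ?_
      (ae_of_all _ fun y ↦ abs_nonneg _) hlr_int)
    rw [uIoc_of_le hle]
    exact Ioc_subset_Ioc (le_min ha.1 hx.1) (max_le ha.2 hx.2)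
  -- Cauchy–Schwarz on a unit interval, obtained by integrating `(|v x| - |v' y|)² ≥ 0` in `y`.
  have hmono : ∫ y in l..r, (2 * |v x| * |v' y| - |v x| ^ 2) ≤ ∫ y in l..r, v' y ^ 2 := by
    refine intervalIntegral.integral_mono_on hle
      ((hlr_int.const_mul _).sub intervalIntegrable_const)
      ((hv'.pow 2).intervalIntegrable_of_Icc hle) fun y _ ↦ ?_
    nlinarith [sq_nonneg (|v x| - |v' y|), sq_abs (v' y)]
  rw [intervalIntegral.integral_sub (hlr_int.const_mul _) intervalIntegrable_const,
    intervalIntegral.integral_const_mul, intervalIntegral.integral_const, smul_eq_mul, hlr] at hmono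
  rw [hlr] at habs ⊢
  nlinarith [abs_nonneg (v x), sq_abs (v x), mul_le_mul_of_nonneg_left habs (abs_nonneg (v x))]

end AbsolutelyContinuous

/-! ### Derivatives of strong solutions -/

section Regularity

variable {l r : ℝ} {v : ℝ → ℝ}

theorem dOn_zero : dOn l r 0 v = v := iteratedDerivWithin_zero

theorem IsStrong4.continuousOn_dOn (hv : IsStrong4 l r v) (hlr : l < r) {k : ℕ} (hk : k ≤ 3) :
    ContinuousOn (dOn l r k v) (Icc l r) :=
  hv.1.continuousOn_iteratedDerivWithin (by exact_mod_cast hk) (uniqueDiffOn_Icc hlr)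

theorem IsStrong4.hasDerivAt_dOn (hv : IsStrong4 l r v) (hlr : l < r) {k : ℕ} (hk : k < 3)
    {x : ℝ} (hx : x ∈ Ioo l r) : HasDerivAt (dOn l r k v) (dOn l r (k + 1) v x) x := by
  have h := (hv.1.differentiableOn_iteratedDerivWithin (m := k) (by exact_mod_cast hk)
    (uniqueDiffOn_Icc hlr) x (Ioo_subset_Icc_self hx)).hasDerivWithinAt
  rw [← iteratedDerivWithin_succ] at h
  exact h.hasDerivAt (Icc_mem_nhds hx.1 hx.2)

theorem IsStrong4.ae_hasDerivAt_dOn_three (hv : IsStrong4 l r v) :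
    ∀ᵐ x ∂(volume.restrict (Ioo l r)), HasDerivAt (dOn l r 3 v) (dOn l r 4 v x) x := by
  rw [ae_restrict_iff' measurableSet_Ioo]
  filter_upwards [hv.2.ae_differentiableAt] with x hx hxI
  have h := (hx (Icc_subset_uIcc (Ioo_subset_Icc_self hxI))).hasDerivAt
  have : dOn l r 4 v x = deriv (dOn l r 3 v) x := by
    rw [← derivWithin_of_mem_nhds (Icc_mem_nhds hxI.1 hxI.2)]
    exact congrFun iteratedDerivWithin_succ x
  rwa [this]

theorem IsStrong4.contDiffOn_dOn (hv : IsStrong4 l r v) (hlr : l < r) {k : ℕ} (hk : k ≤ 2) :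
    ContDiffOn ℝ 1 (dOn l r k v) (Icc l r) := by
  have hu := uniqueDiffOn_Icc hlr
  have hsucc : derivWithin (dOn l r k v) (Icc l r) = dOn l r (k + 1) v :=
    iteratedDerivWithin_succ.symm
  rw [show (1 : ℕ∞ω) = 0 + 1 from (zero_add 1).symm, contDiffOn_succ_iff_derivWithin hu]
  refine ⟨hv.1.differentiableOn_iteratedDerivWithin (by exact_mod_cast Nat.lt_succ_of_le hk) hu,
    by simp, ?_⟩
  rw [hsucc, contDiffOn_zero]
  exact hv.continuousOn_dOn hlr (by omega)

end Regularity

/-! ### The energy estimate on one interval -/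

section Energy

/-- The boundary term of the energy identity for `ε² u'''' - b u'' + c u`, tested with `u - g`,
where `g₁` stands for `g'`. -/
noncomputable def energyFlux (ε l r : ℝ) (b u g g₁ : ℝ → ℝ) (x : ℝ) : ℝ :=
  ε ^ 2 * (dOn l r 3 u x * (u x - g x) - dOn l r 2 u x * (dOn l r 1 u x - g₁ x))
    - b x * ((dOn l r 1 u x - g₁ x) * (u x - g x))

/-- Pointwise form of the energy estimate (Young's inequality). -/
theorem energy_density_le {ε s γ B D K G Q b b₁ c F u u₂ u₄ g g₂ w w₁ w₂ : ℝ}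
    (hs : 0 < s) (hγ : 0 < γ) (hb : s ≤ b) (hb₁ : |b₁| ≤ B)
    (hc : γ ≤ c - D / 2 - B ^ 2 / (2 * s)) (hg₂ : |g₂| ≤ G)
    (heq : ε ^ 2 * u₄ - b * u₂ + c * u = F) (hw : w = u - g) (hw₂ : w₂ = u₂ - g₂)
    (hF : (F - c * g + b * g₂) * w ≤ K * |w| + Q) :
    ε ^ 2 * (u₄ * w - u₂ * w₂) - b₁ * (w₁ * w) - b * (w₂ * w + w₁ * w₁) ≤
      K ^ 2 / (2 * γ) + ε ^ 2 * G ^ 2 / 2 + Q - D / 2 * w ^ 2 - s / 2 * w₁ ^ 2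
        - ε ^ 2 / 2 * w₂ ^ 2 := by
  have key : ε ^ 2 * (u₄ * w - u₂ * w₂) - b₁ * (w₁ * w) - b * (w₂ * w + w₁ * w₁) =
      (F - c * g + b * g₂) * w - c * w ^ 2 - ε ^ 2 * w₂ ^ 2 - ε ^ 2 * (g₂ * w₂)
        - b₁ * (w₁ * w) - b * w₁ ^ 2 := by
    subst hw hw₂
    linear_combination (u - g) * heq
  -- Half of `γ`, of `s` and of `ε²` is spent on the source, the `b'` term and the lifting
  -- respectively. The other halves of `s` and `ε²` are the energy kept; that of `γ` is dropped in
  -- `h6`.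
  have h1 : K * |w| ≤ K ^ 2 / (2 * γ) + γ / 2 * w ^ 2 := by
    have : K ^ 2 / (2 * γ) + γ / 2 * w ^ 2 - K * |w| = (K - γ * |w|) ^ 2 / (2 * γ) := by
      rw [← sq_abs w]; field_simp; ring
    have : 0 ≤ (K - γ * |w|) ^ 2 / (2 * γ) := by positivity
    linarith
  have h2 : -(b₁ * (w₁ * w)) ≤ s / 2 * w₁ ^ 2 + B ^ 2 / (2 * s) * w ^ 2 := by
    have e : s / 2 * w₁ ^ 2 + b₁ ^ 2 / (2 * s) * w ^ 2 + b₁ * (w₁ * w)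
        = (s * w₁ + b₁ * w) ^ 2 / (2 * s) := by
      field_simp; ring
    have p : 0 ≤ (s * w₁ + b₁ * w) ^ 2 / (2 * s) := by positivity
    have : b₁ ^ 2 / (2 * s) * w ^ 2 ≤ B ^ 2 / (2 * s) * w ^ 2 := by
      have := sq_le_sq' (abs_le.1 hb₁).1 (abs_le.1 hb₁).2
      gcongr
    linarith
  have h3 : -(ε ^ 2 * (g₂ * w₂)) ≤ ε ^ 2 * G ^ 2 / 2 + ε ^ 2 / 2 * w₂ ^ 2 := by
    have := sq_le_sq' (abs_le.1 hg₂).1 (abs_le.1 hg₂).2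
    have : -(g₂ * w₂) ≤ G ^ 2 / 2 + w₂ ^ 2 / 2 := by nlinarith [sq_nonneg (g₂ + w₂)]
    have := mul_le_mul_of_nonneg_left this (sq_nonneg ε)
    linarith
  have h4 : s * w₁ ^ 2 ≤ b * w₁ ^ 2 := by gcongr
  have h5 := mul_le_mul_of_nonneg_right hc (sq_nonneg w)
  have h6 : 0 ≤ γ / 2 * w ^ 2 := by positivity
  rw [key]
  linarith

/-- Integrated energy estimate on one interval. -/
theorem IsStrong4.energyFlux_sub_le {ε l r s γ B D K G : ℝ} {b c F u g g₁ g₂ Q : ℝ → ℝ}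
    (hu : IsStrong4 l r u) (hlr : l < r) (hbs : ContDiffOn ℝ ∞ b (Icc l r))
    (hg : ∀ x, HasDerivAt g (g₁ x) x) (hg₁ : ∀ x, HasDerivAt g₁ (g₂ x) x) (hg₂ : Continuous g₂)
    (hs : 0 < s) (hγ : 0 < γ) (hb : ∀ x ∈ Icc l r, s ≤ b x)
    (hb₁ : ∀ᵐ x ∂(volume.restrict (Ioo l r)), |deriv b x| ≤ B)
    (hc : ∀ x ∈ Icc l r, γ ≤ c x - D / 2 - B ^ 2 / (2 * s))
    (hG : ∀ x ∈ Icc l r, |g₂ x| ≤ G)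
    (heq : ∀ᵐ x ∂(volume.restrict (Ioo l r)),
      ε ^ 2 * dOn l r 4 u x - b x * dOn l r 2 u x + c x * u x = F x)
    (hQ : ContinuousOn Q (Icc l r))
    (hF : ∀ᵐ x ∂(volume.restrict (Ioo l r)),
      (F x - c x * g x + b x * g₂ x) * (u x - g x) ≤ K * |u x - g x| + Q x) :
    energyFlux ε l r b u g g₁ r - energyFlux ε l r b u g g₁ l ≤
      (K ^ 2 / (2 * γ) + ε ^ 2 * G ^ 2 / 2) * (r - l) + (∫ x in l..r, Q x)
        - D / 2 * (∫ x in l..r, (u x - g x) ^ 2)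
        - s / 2 * (∫ x in l..r, (dOn l r 1 u x - g₁ x) ^ 2)
        - ε ^ 2 / 2 * (∫ x in l..r, (dOn l r 2 u x - g₂ x) ^ 2) := by
  have hle := hlr.le
  have hgc : Continuous g := continuous_iff_continuousAt.2 fun x ↦ (hg x).continuousAt
  have hg₁c : Continuous g₁ := continuous_iff_continuousAt.2 fun x ↦ (hg₁ x).continuousAt
  have hgC : ContDiff ℝ 1 g := by
    rw [contDiff_one_iff_deriv]
    refine ⟨fun x ↦ (hg x).differentiableAt, ?_⟩
    rwa [show deriv g = g₁ from funext fun x ↦ (hg x).deriv]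
  have hg₁C : ContDiff ℝ 1 g₁ := by
    rw [contDiff_one_iff_deriv]
    refine ⟨fun x ↦ (hg₁ x).differentiableAt, ?_⟩
    rwa [show deriv g₁ = g₂ from funext fun x ↦ (hg₁ x).deriv]
  have hu0 := hu.contDiffOn_dOn hlr (k := 0) (by norm_num)
  rw [dOn_zero] at hu0
  have hwC : ContDiffOn ℝ 1 (fun x ↦ u x - g x) (Icc l r) := hu0.sub hgC.contDiffOn
  have hw₁C : ContDiffOn ℝ 1 (fun x ↦ dOn l r 1 u x - g₁ x) (Icc l r) :=
    (hu.contDiffOn_dOn hlr (by norm_num)).sub hg₁C.contDiffOn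
  have hw₂c : ContinuousOn (fun x ↦ dOn l r 2 u x - g₂ x) (Icc l r) :=
    (hu.continuousOn_dOn hlr (by norm_num)).sub hg₂.continuousOn
  have ac : ∀ {φ : ℝ → ℝ}, ContDiffOn ℝ 1 φ (Icc l r) → AbsolutelyContinuousOnInterval φ l r :=
    fun h ↦ ContDiffOn.absolutelyContinuousOnInterval (by rwa [uIcc_of_le hle])
  have hP : AbsolutelyContinuousOnInterval (energyFlux ε l r b u g g₁) l r := by
    refine AbsolutelyContinuousOnInterval.fun_sub
      (AbsolutelyContinuousOnInterval.const_mul _ ((hu.2.fun_mul (ac hwC)).fun_sub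
        ((ac (hu.contDiffOn_dOn hlr le_rfl)).fun_mul (ac hw₁C)))) ?_
    exact (ac (hbs.of_le (by exact_mod_cast le_top))).fun_mul ((ac hw₁C).fun_mul (ac hwC))
  have hi : ∀ {φ : ℝ → ℝ} (k : ℝ), ContinuousOn φ (Icc l r) →
      IntervalIntegrable (fun x ↦ k * φ x ^ 2) volume l r := fun k h ↦
    (continuousOn_const.mul (h.pow 2)).intervalIntegrable_of_Icc hle
  have main := hP.sub_le_integral hle
    (P' := fun x ↦ ε ^ 2 * (dOn l r 4 u x * (u x - g x)
        - dOn l r 2 u x * (dOn l r 2 u x - g₂ x))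
      - deriv b x * ((dOn l r 1 u x - g₁ x) * (u x - g x))
      - b x * ((dOn l r 2 u x - g₂ x) * (u x - g x)
        + (dOn l r 1 u x - g₁ x) * (dOn l r 1 u x - g₁ x)))
    (h := fun x ↦ K ^ 2 / (2 * γ) + ε ^ 2 * G ^ 2 / 2 + Q x - D / 2 * (u x - g x) ^ 2
      - s / 2 * (dOn l r 1 u x - g₁ x) ^ 2 - ε ^ 2 / 2 * (dOn l r 2 u x - g₂ x) ^ 2)
    ((((continuousOn_const.add hQ).sub (continuousOn_const.mul (hwC.continuousOn.pow 2))).sub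
      (continuousOn_const.mul (hw₁C.continuousOn.pow 2))).sub
      (continuousOn_const.mul (hw₂c.pow 2))) ?_ ?_
  · refine main.trans_eq ?_
    have hQi : IntervalIntegrable Q volume l r := hQ.intervalIntegrable_of_Icc hle
    have hci : IntervalIntegrable (fun _ ↦ K ^ 2 / (2 * γ) + ε ^ 2 * G ^ 2 / 2) volume l r :=
      intervalIntegrable_const
    have hi₀ := hi (D / 2) hwC.continuousOn
    have hi₁ := hi (s / 2) hw₁C.continuousOn
    have hi₂ := hi (ε ^ 2 / 2) hw₂c
    rw [intervalIntegral.integral_sub (((hci.add hQi).sub hi₀).sub hi₁) hi₂,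
      intervalIntegral.integral_sub ((hci.add hQi).sub hi₀) hi₁,
      intervalIntegral.integral_sub (hci.add hQi) hi₀,
      intervalIntegral.integral_add hci hQi]
    simp only [intervalIntegral.integral_const_mul, intervalIntegral.integral_const, smul_eq_mul]
    ring
  · filter_upwards [hu.ae_hasDerivAt_dOn_three, ae_restrict_mem measurableSet_Ioo] with x h3 hx
    have h0 := hu.hasDerivAt_dOn hlr (k := 0) (by norm_num) hx
    rw [dOn_zero] at h0
    have h1 := hu.hasDerivAt_dOn hlr (k := 1) (by norm_num) hx
    have h2 := hu.hasDerivAt_dOn hlr (k := 2) (by norm_num) hx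
    have hbd : HasDerivAt b (deriv b x) x :=
      ((hbs.differentiableOn (by simp)).differentiableAt (Icc_mem_nhds hx.1 hx.2)).hasDerivAt
    have hw := h0.sub (hg x)
    have hw₁ := h1.sub (hg₁ x)
    convert! (((h3.mul hw).sub (h2.mul hw₁)).const_mul (ε ^ 2)).sub (hbd.mul (hw₁.mul hw)) using 1
    simp only [Pi.sub_apply, Pi.mul_apply]
    ring
  · filter_upwards [heq, hF, hb₁, ae_restrict_mem measurableSet_Ioo] with x h1 h2 h3 hx
    have hx' := Ioo_subset_Icc_self hx
    exact energy_density_le hs hγ (hb x hx') h3 (hc x hx') (hG x hx') h1 rfl rfl h2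

end Energy

/-! ### Essential bounds -/

section Linfty

variable {D : Set ℝ} {g : ℝ → ℝ}

theorem linftyNorm_nonneg : 0 ≤ linftyNorm D g := ENNReal.toReal_nonneg

theorem MemLinfty.ae_abs_le (hg : MemLinfty D g) :
    ∀ᵐ x ∂(volume.restrict D), |g x| ≤ linftyNorm D g := by
  have h : ∀ᵐ x ∂(volume.restrict D), ‖g x‖ₑ ≤ eLpNorm g ∞ (volume.restrict D) := by
    rw [eLpNorm_exponent_top]
    exact ae_le_eLpNormEssSup
  filter_upwards [h] with x hx
  simpa [linftyNorm] using ENNReal.toReal_mono hg.2.ne hx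

theorem memLinfty_of_bound {M : ℝ} (hD : MeasurableSet D)
    (hm : AEStronglyMeasurable g (volume.restrict D)) (hM : ∀ x ∈ D, |g x| ≤ M) :
    MemLinfty D g :=
  memLp_top_of_bound hm M ((ae_restrict_iff' hD).2 (ae_of_all _ hM))

theorem linftyNorm_le_of_bound {M : ℝ} (hM0 : 0 ≤ M) (hD : MeasurableSet D)
    (hM : ∀ x ∈ D, |g x| ≤ M) : linftyNorm D g ≤ M := by
  refine ENNReal.toReal_le_of_le_ofReal hM0 ?_
  rw [eLpNorm_exponent_top]
  exact eLpNormEssSup_le_of_ae_bound ((ae_restrict_iff' hD).2 (ae_of_all _ hM))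

theorem ContinuousOn.memLinfty_of_subset_Icc {l r : ℝ} (hg : ContinuousOn g (Icc l r))
    (hD : MeasurableSet D) (hsub : D ⊆ Icc l r) : MemLinfty D g := by
  obtain ⟨M, hM⟩ := isCompact_Icc.exists_bound_of_continuousOn hg
  exact memLinfty_of_bound hD ((hg.mono hsub).aestronglyMeasurable hD) fun x hx ↦ hM x (hsub hx)

/-- Membership is what makes `linftyNorm` of `deriv b` a genuine bound, since `toReal` sends `∞` to
`0`. Inside the interval `deriv` agrees with the one-sided derivative, which is continuous up to the
end points. -/
theorem ContDiffOn.memLinfty_deriv {l r : ℝ} (hlr : l < r) (hg : ContDiffOn ℝ 1 g (Icc l r)) :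
    MemLinfty (Ioo l r) (deriv g) := by
  have h := (hg.continuousOn_derivWithin (uniqueDiffOn_Icc hlr) le_rfl).memLinfty_of_subset_Icc
    measurableSet_Ioo Ioo_subset_Icc_self
  refine (memLp_congr_ae ?_).1 h
  filter_upwards [ae_restrict_mem measurableSet_Ioo] with x hx
  exact derivWithin_of_mem_nhds (Icc_mem_nhds hx.1 hx.2)

end Linfty

/-! ### Lifting of the boundary data -/

section Lifting

/-- The cubic with value `p₀`, slope `p₁` at `1` and value `q₀`, slope `q₁` at `2`. -/
theorem exists_hermite_cubic {p₀ p₁ q₀ q₁ A : ℝ} (hp₀ : |p₀| ≤ A) (hp₁ : |p₁| ≤ A)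
    (hq₀ : |q₀| ≤ A) (hq₁ : |q₁| ≤ A) :
    ∃ g g₁ g₂ : ℝ → ℝ, (∀ x, HasDerivAt g (g₁ x) x) ∧ (∀ x, HasDerivAt g₁ (g₂ x) x) ∧
      Continuous g₂ ∧ g 1 = p₀ ∧ g₁ 1 = p₁ ∧ g 2 = q₀ ∧ g₁ 2 = q₁ ∧
      (∀ x ∈ Icc (1 : ℝ) 2, |g x| ≤ 20 * A) ∧ ∀ x ∈ Icc (1 : ℝ) 2, |g₂ x| ≤ 60 * A := by
  obtain ⟨m, hm⟩ : ∃ m, m = 3 * (q₀ - p₀) - 2 * p₁ - q₁ := ⟨_, rfl⟩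
  obtain ⟨n, hn⟩ : ∃ n, n = 2 * (p₀ - q₀) + p₁ + q₁ := ⟨_, rfl⟩
  have hA : 0 ≤ A := (abs_nonneg _).trans hp₀
  rw [abs_le] at hp₀ hp₁ hq₀ hq₁
  -- These bounds give `1 + 1 + 9 + 6 = 17 ≤ 20` for the cubic and `2 * 9 + 6 * 6 = 54 ≤ 60` for its
  -- second derivative.
  have hm' : |m| ≤ 9 * A := by rw [abs_le]; constructor <;> linarith
  have hn' : |n| ≤ 6 * A := by rw [abs_le]; constructor <;> linarith
  refine ⟨fun x ↦ p₀ + p₁ * (x - 1) + m * (x - 1) ^ 2 + n * (x - 1) ^ 3,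
    fun x ↦ p₁ + 2 * m * (x - 1) + 3 * n * (x - 1) ^ 2,
    fun x ↦ 2 * m + 6 * n * (x - 1), fun x ↦ ?_, fun x ↦ ?_, by fun_prop, by simp, by simp,
    by rw [hm, hn]; ring, by rw [hm, hn]; ring, fun x hx ↦ ?_, fun x hx ↦ ?_⟩
  · have h := (hasDerivAt_id' x).sub_const 1
    convert! (((h.const_mul p₁).const_add p₀).add ((h.pow 2).const_mul m)).add
      ((h.pow 3).const_mul n) using 1
    push_cast; ring
  · have h := (hasDerivAt_id' x).sub_const 1
    convert! ((h.const_mul (2 * m)).const_add p₁).add ((h.pow 2).const_mul (3 * n)) using 1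
    push_cast; ring
  · have ht : |x - 1| ≤ 1 := by rw [abs_le]; constructor <;> linarith [hx.1, hx.2]
    have bd : ∀ {y B : ℝ} (k : ℕ), |y| ≤ B → |y * (x - 1) ^ k| ≤ B := fun {y B} k hy ↦ by
      rw [abs_mul, abs_pow]
      exact (mul_le_of_le_one_right (abs_nonneg _) (pow_le_one₀ (abs_nonneg _) ht)).trans hy
    have h1 := abs_le.1 (bd 1 (abs_le.2 hp₁))
    have h2 := abs_le.1 (bd 2 hm')
    have h3 := abs_le.1 (bd 3 hn')
    rw [pow_one] at h1
    rw [abs_le]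
    constructor <;> linarith
  · have ht : |x - 1| ≤ 1 := by rw [abs_le]; constructor <;> linarith [hx.1, hx.2]
    have h1 : |n * (x - 1)| ≤ 6 * A := by
      rw [abs_mul]
      exact (mul_le_of_le_one_right (abs_nonneg _) ht).trans hn'
    rw [abs_le] at h1 hm' ⊢
    constructor <;> linarith

end Lifting

/-! ### The a priori bound -/

section Main

/-- From the energy bound to a pointwise bound, uniformly in `ε`: the first derivative is used for
`ε ≤ 1`, the second one for `ε > 1`. -/
theorem sq_le_of_energy_bound {ε s N S I J I' J' : ℝ} (hε : 0 < ε) (hs : 0 < s) (hN : 0 ≤ N)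
    (hI : 0 ≤ I) (hJ : 0 ≤ J) (hI' : 0 ≤ I') (hJ' : 0 ≤ J')
    (hE : s / 2 * (I + I') + ε ^ 2 / 2 * (J + J') ≤ (1 + ε ^ 2) * N)
    (hSI : S ≤ I) (hSJ : S ≤ J) : S ≤ 4 * (1 + 1 / s) * N := by
  have e : 4 * (1 + 1 / s) * N = 4 * N + 4 * N / s := by ring
  have hNs : 0 ≤ 4 * N / s := by positivity
  rw [e]
  -- The right-hand side is at most `2 * N` if `ε ≤ 1`, and at most `2 * ε ^ 2 * N` if `ε > 1`.
  rcases le_or_gt ε 1 with h | h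
  · have : ε ^ 2 ≤ 1 := pow_le_one₀ hε.le h
    have : I ≤ 4 * N / s := by
      rw [le_div_iff₀ hs]
      nlinarith [mul_nonneg hs.le hI', mul_nonneg (sq_nonneg ε) (add_nonneg hJ hJ')]
    linarith
  · have h1 : 1 ≤ ε ^ 2 := one_le_pow₀ h.le
    have : ε ^ 2 * J ≤ ε ^ 2 * (4 * N) := by
      nlinarith [mul_nonneg hs.le (add_nonneg hI hI'), mul_nonneg (sq_nonneg ε) hJ']
    have := le_of_mul_le_mul_left this (by positivity)
    linarith

/-- A strong solution whose deviation `u - g` vanishes to first order at a point is bounded by both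
energies. -/
theorem IsStrong4.sq_sub_le {l r a : ℝ} {u g g₁ g₂ : ℝ → ℝ} (hu : IsStrong4 l r u)
    (hlr : r = l + 1) (hg : ∀ x, HasDerivAt g (g₁ x) x) (hg₁ : ∀ x, HasDerivAt g₁ (g₂ x) x)
    (hg₂ : Continuous g₂) (ha : a ∈ Icc l r) (h0 : u a = g a) (h1 : dOn l r 1 u a = g₁ a)
    {x : ℝ} (hx : x ∈ Icc l r) :
    (u x - g x) ^ 2 ≤ ∫ y in l..r, (dOn l r 1 u y - g₁ y) ^ 2 ∧
      (u x - g x) ^ 2 ≤ ∫ y in l..r, (dOn l r 2 u y - g₂ y) ^ 2 := by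
  have hlt : l < r := by linarith
  have hgc : Continuous g := continuous_iff_continuousAt.2 fun x ↦ (hg x).continuousAt
  have hg₁c : Continuous g₁ := continuous_iff_continuousAt.2 fun x ↦ (hg₁ x).continuousAt
  have c0 := hu.continuousOn_dOn hlt (k := 0) (by norm_num)
  have c1 := hu.continuousOn_dOn hlt (k := 1) (by norm_num)
  have c2 := hu.continuousOn_dOn hlt (k := 2) (by norm_num)
  rw [dOn_zero] at c0
  have i1 : ∀ y ∈ Icc l r, (u y - g y) ^ 2 ≤ ∫ z in l..r, (dOn l r 1 u z - g₁ z) ^ 2 := by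
    intro y hy
    refine sq_le_integral_sq_deriv (v := fun y ↦ u y - g y) (v' := fun y ↦ dOn l r 1 u y - g₁ y)
      hlr (c0.sub hgc.continuousOn) (c1.sub hg₁c.continuousOn) (fun z hz ↦ ?_) ha
      (sub_eq_zero.2 h0) hy
    have := hu.hasDerivAt_dOn hlt (k := 0) (by norm_num) hz
    rw [dOn_zero] at this
    exact this.sub (hg z)
  have i2 : ∀ y ∈ Icc l r,
      (dOn l r 1 u y - g₁ y) ^ 2 ≤ ∫ z in l..r, (dOn l r 2 u z - g₂ z) ^ 2 := fun y hy ↦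
    sq_le_integral_sq_deriv (v := fun y ↦ dOn l r 1 u y - g₁ y)
      (v' := fun y ↦ dOn l r 2 u y - g₂ y)
      hlr (c1.sub hg₁c.continuousOn) (c2.sub hg₂.continuousOn)
      (fun z hz ↦ (hu.hasDerivAt_dOn hlt (by norm_num) hz).sub (hg₁ z)) ha (sub_eq_zero.2 h1) hy
  refine ⟨i1 x hx, (i1 x hx).trans ?_⟩
  have := intervalIntegral.integral_mono_on (μ := volume) hlt.le
    (((c1.sub hg₁c.continuousOn).pow 2).intervalIntegrable_of_Icc hlt.le)
    intervalIntegrable_const i2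
  simpa [hlr] using this

/-- Add `(D - δ)(v - w)² ≥ 0` and `(D + δ)(v + w)² ≥ 0`. The equal weights are what lets the delay
term cancel on both intervals. -/
theorem neg_mul_mul_le {D δ v w : ℝ} (h : |δ| ≤ D) :
    -(δ * v * w) ≤ D / 2 * v ^ 2 + D / 2 * w ^ 2 := by
  have h1 := mul_nonneg (sub_nonneg.2 (abs_le.1 h).2) (sq_nonneg (v - w))
  have h2 := mul_nonneg (neg_le_iff_add_nonneg.1 (neg_le.1 (abs_le.1 h).1)) (sq_nonneg (v + w))
  linarith

/-- The a priori bound, with the data collected in one number `A`. -/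
theorem SplitSystem.abs_solution_le {ε s γ B D Nb Nc Nd A a₀ b₀ a₁ b₁ a₂ b₂ : ℝ}
    {b c d f Φ u₁ u₂ : ℝ → ℝ} (hε : 0 < ε)
    (h : SplitSystem ε b c d f Φ u₁ u₂)
    (hbs : ContDiffOn ℝ ∞ b (Icc 0 2)) (hs : 0 < s) (hγ : 0 < γ)
    (hb : ∀ x ∈ Icc (0 : ℝ) 2, s ≤ b x)
    (hb' : ∀ᵐ x ∂(volume.restrict (Ioo (0 : ℝ) 2)), |deriv b x| ≤ B)
    (hd' : ∀ᵐ x ∂(volume.restrict (Ioo (1 : ℝ) 2)), |d x| ≤ D)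
    (hc : ∀ x ∈ Icc (0 : ℝ) 2, γ ≤ c x - D / 2 - B ^ 2 / (2 * s))
    (hNb : ∀ x ∈ Icc (0 : ℝ) 2, |b x| ≤ Nb) (hNc : ∀ x ∈ Icc (0 : ℝ) 2, |c x| ≤ Nc)
    (hNd : ∀ x ∈ Icc (0 : ℝ) 2, |d x| ≤ Nd)
    (hf : ∀ᵐ x ∂(volume.restrict (Ioo (0 : ℝ) 2)), |f x| ≤ A)
    (hΦ : ∀ᵐ x ∂(volume.restrict (Ioo (-1 : ℝ) 0)), |Φ x| ≤ A)
    (hu0 : u₁ 0 = a₀) (hu0' : dOn 0 1 1 u₁ 0 = b₀)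
    (hu1 : u₂ 1 = u₁ 1 + (a₁ - (a₀ + b₀))) (hu1' : dOn 1 2 1 u₂ 1 = dOn 0 1 1 u₁ 1 + (b₁ - b₀))
    (hu2 : u₂ 2 = a₂) (hu2' : dOn 1 2 1 u₂ 2 = b₂)
    (hj2 : jumpAtOne 2 u₁ u₂ = 0) (hj3 : jumpAtOne 3 u₁ u₂ = 0)
    (hA₀ : |a₀| + |b₀| ≤ A) (hA₁ : |a₁| ≤ A) (hB₁ : |b₁| ≤ A) (hA₂ : |a₂| ≤ A) (hB₂ : |b₂| ≤ A) :
    (∀ x ∈ Icc (0 : ℝ) 1, |u₁ x| ≤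
      (√(4 * (1 + 1 / s) * ((1 + Nd + 20 * Nc + 60 * Nb) ^ 2 / γ + 3600)) + 20) * A) ∧
    ∀ x ∈ Icc (1 : ℝ) 2, |u₂ x| ≤
      (√(4 * (1 + 1 / s) * ((1 + Nd + 20 * Nc + 60 * Nb) ^ 2 / γ + 3600)) + 20) * A := by
  -- `κ * A` bounds the source left after lifting: `f`, the known part of the delay term, `c g` and
  -- `b g''`.
  obtain ⟨κ, hκ⟩ : ∃ κ, κ = 1 + Nd + 20 * Nc + 60 * Nb := ⟨_, rfl⟩
  rw [← hκ]
  have hA : 0 ≤ A := (abs_nonneg _).trans hA₁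
  have hzero : (0 : ℝ) ∈ Icc (0 : ℝ) 2 := by simp
  have hNb0 : 0 ≤ Nb := (abs_nonneg _).trans (hNb 0 hzero)
  have hNc0 : 0 ≤ Nc := (abs_nonneg _).trans (hNc 0 hzero)
  have hNd0 : 0 ≤ Nd := (abs_nonneg _).trans (hNd 0 hzero)
  have sub₁ : Icc (0 : ℝ) 1 ⊆ Icc 0 2 := Icc_subset_Icc_right (by norm_num)
  have sub₂ : Icc (1 : ℝ) 2 ⊆ Icc 0 2 := Icc_subset_Icc_left (by norm_num)
  have sub₁' : Ioo (0 : ℝ) 1 ⊆ Ioo 0 2 := Ioo_subset_Ioo_right (by norm_num)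
  have sub₂' : Ioo (1 : ℝ) 2 ⊆ Ioo 0 2 := Ioo_subset_Ioo_left (by norm_num)
  -- the lifting `k` on `[0, 1]` and `g` on `[1, 2]`
  obtain ⟨k, hk⟩ : ∃ k : ℝ → ℝ, k = fun x ↦ a₀ + b₀ * x := ⟨_, rfl⟩
  have hk1 : ∀ x, HasDerivAt k b₀ x := fun x ↦ by
    rw [hk]; simpa using ((hasDerivAt_id' x).const_mul b₀).const_add a₀
  have hkA : ∀ x ∈ Icc (0 : ℝ) 1, |k x| ≤ A := fun x hx ↦ by
    have : |b₀ * x| ≤ |b₀| := by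
      rw [abs_mul]
      exact mul_le_of_le_one_right (abs_nonneg _) (by rw [abs_of_nonneg hx.1]; exact hx.2)
    rw [hk]
    exact (abs_add_le _ _).trans (by linarith)
  obtain ⟨g, g₁, g₂, hg, hg₁, hg₂, e1, e1', e2, e2', hgA, hg₂A⟩ :=
    exists_hermite_cubic hA₁ hB₁ hA₂ hB₂
  have hw_cont : ContinuousOn (fun x ↦ u₁ x - k x) (Icc 0 1) := by
    have := h.reg₁.continuousOn_dOn one_pos (k := 0) (by norm_num)
    rw [dOn_zero] at this
    exact this.sub (continuous_iff_continuousAt.2 fun x ↦ (hk1 x).continuousAt).continuousOn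
  -- The affine lift has zero second derivative; `G := 60 * A` is taken only to share the constant
  -- with `[1, 2]`. The history is known data, so no `Q` is needed here.
  have E₁ := h.reg₁.energyFlux_sub_le (g := k) (g₁ := fun _ ↦ b₀) (g₂ := fun _ ↦ 0)
    (G := 60 * A) (K := κ * A) (Q := fun _ ↦ 0) one_pos (hbs.mono sub₁) hk1
    (fun x ↦ hasDerivAt_const x b₀) continuous_const hs hγ (fun x hx ↦ hb x (sub₁ hx))
    (ae_restrict_of_ae_restrict_of_subset sub₁' hb') (fun x hx ↦ hc x (sub₁ hx))
    (fun x _ ↦ by rw [abs_zero]; positivity) h.eq₁ continuousOn_const (by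
      have hΦ' : ∀ᵐ x ∂(volume.restrict (Ioo (0 : ℝ) 1)), |Φ (x - 1)| ≤ A := by
        rw [ae_restrict_iff' measurableSet_Ioo] at hΦ ⊢
        filter_upwards [(measurePreserving_sub_right volume (1 : ℝ)).quasiMeasurePreserving.ae hΦ]
          with x hx hxI
        exact hx ⟨by linarith [hxI.1], by linarith [hxI.2]⟩
      filter_upwards [ae_restrict_of_ae_restrict_of_subset sub₁' hf, hΦ',
        ae_restrict_mem measurableSet_Ioo] with x h1 h2 hx
      have hx' := Ioo_subset_Icc_self hx
      have h3 : |d x * Φ (x - 1)| ≤ Nd * A := by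
        rw [abs_mul]; exact mul_le_mul (hNd x (sub₁ hx')) h2 (abs_nonneg _) hNd0
      have h4 : |c x * k x| ≤ Nc * A := by
        rw [abs_mul]; exact mul_le_mul (hNc x (sub₁ hx')) (hkA x hx') (abs_nonneg _) hNc0
      have h5 : |f x - d x * Φ (x - 1) - c x * k x + b x * 0| ≤ κ * A := by
        have := mul_nonneg hNc0 hA
        have := mul_nonneg hNb0 hA
        rw [abs_le] at h1 h3 h4 ⊢
        rw [hκ]
        constructor <;> linarith
      refine (le_abs_self _).trans ?_
      rw [abs_mul, add_zero]
      gcongr)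
  have shift_maps : MapsTo (fun x : ℝ ↦ x - 1) (Icc 1 2) (Icc 0 1) :=
    fun x hx ↦ ⟨by linarith [hx.1], by linarith [hx.2]⟩
  have hv_cont : ContinuousOn (fun x ↦ u₁ (x - 1) - k (x - 1)) (Icc 1 2) :=
    hw_cont.comp (by fun_prop) shift_maps
  have hw₂_cont : ContinuousOn (fun x ↦ u₂ x - g x) (Icc 1 2) := by
    have := h.reg₂.continuousOn_dOn one_lt_two (k := 0) (by norm_num)
    rw [dOn_zero] at this
    exact this.sub (continuous_iff_continuousAt.2 fun x ↦ (hg x).continuousAt).continuousOn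
  -- In the delay term `u₁ (x - 1)` is split into the lift, which joins the source, and the
  -- deviation, which goes into `Q`.
  have E₂ := h.reg₂.energyFlux_sub_le (K := κ * A)
    (Q := fun x ↦ D / 2 * (u₁ (x - 1) - k (x - 1)) ^ 2 + D / 2 * (u₂ x - g x) ^ 2)
    one_lt_two (hbs.mono sub₂) hg hg₁ hg₂ hs hγ (fun x hx ↦ hb x (sub₂ hx))
    (ae_restrict_of_ae_restrict_of_subset sub₂' hb') (fun x hx ↦ hc x (sub₂ hx))
    hg₂A h.eq₂ ((continuousOn_const.mul (hv_cont.pow 2)).add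
      (continuousOn_const.mul (hw₂_cont.pow 2))) (by
      filter_upwards [ae_restrict_of_ae_restrict_of_subset sub₂' hf, hd',
        ae_restrict_mem measurableSet_Ioo] with x h1 h2 hx
      have hx' := Ioo_subset_Icc_self hx
      have h3 : |d x * k (x - 1)| ≤ Nd * A := by
        rw [abs_mul]
        exact mul_le_mul (hNd x (sub₂ hx')) (hkA _ (shift_maps hx')) (abs_nonneg _) hNd0
      have h4 : |c x * g x| ≤ Nc * (20 * A) := by
        rw [abs_mul]; exact mul_le_mul (hNc x (sub₂ hx')) (hgA x hx') (abs_nonneg _) hNc0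
      have h5 : |b x * g₂ x| ≤ Nb * (60 * A) := by
        rw [abs_mul]; exact mul_le_mul (hNb x (sub₂ hx')) (hg₂A x hx') (abs_nonneg _) hNb0
      have h6 : |f x - d x * k (x - 1) - c x * g x + b x * g₂ x| ≤ κ * A := by
        rw [abs_le] at h1 h3 h4 h5 ⊢
        rw [hκ]
        constructor <;> linarith
      have h7 : -(d x * (u₁ (x - 1) - k (x - 1)) * (u₂ x - g x)) ≤
          D / 2 * (u₁ (x - 1) - k (x - 1)) ^ 2 + D / 2 * (u₂ x - g x) ^ 2 :=
        neg_mul_mul_le h2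
      have h8 : (f x - d x * k (x - 1) - c x * g x + b x * g₂ x) * (u₂ x - g x) ≤
          κ * A * |u₂ x - g x| := by
        refine (le_abs_self _).trans ?_
        rw [abs_mul]
        gcongr
      linarith)
  -- the flux has no jump at `1` and vanishes at `0` and `2`
  have hk0 : k 0 = a₀ := by simp [hk]
  have hk11 : k 1 = a₀ + b₀ := by simp [hk]
  have F0 : energyFlux ε 0 1 b u₁ k (fun _ ↦ b₀) 0 = 0 := by
    simp [energyFlux, hu0, hu0', hk0]
  have F2 : energyFlux ε 1 2 b u₂ g g₁ 2 = 0 := by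
    simp [energyFlux, hu2, hu2', e2, e2']
  have F1 : energyFlux ε 1 2 b u₂ g g₁ 1 = energyFlux ε 0 1 b u₁ k (fun _ ↦ b₀) 1 := by
    have j2 : dOn 1 2 2 u₂ 1 = dOn 0 1 2 u₁ 1 := sub_eq_zero.1 hj2
    have j3 : dOn 1 2 3 u₂ 1 = dOn 0 1 3 u₁ 1 := sub_eq_zero.1 hj3
    simp only [energyFlux, j2, j3, e1, e1', hu1, hu1', hk11]
    ring
  have hQ : ∫ x in (1 : ℝ)..2,
        (D / 2 * (u₁ (x - 1) - k (x - 1)) ^ 2 + D / 2 * (u₂ x - g x) ^ 2) =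
      D / 2 * (∫ x in (0 : ℝ)..1, (u₁ x - k x) ^ 2) +
        D / 2 * ∫ x in (1 : ℝ)..2, (u₂ x - g x) ^ 2 := by
    have i₁ : IntervalIntegrable (fun x ↦ D / 2 * (u₁ (x - 1) - k (x - 1)) ^ 2) volume 1 2 :=
      (continuousOn_const.mul (hv_cont.pow 2)).intervalIntegrable_of_Icc one_le_two
    have i₂ : IntervalIntegrable (fun x ↦ D / 2 * (u₂ x - g x) ^ 2) volume 1 2 :=
      (continuousOn_const.mul (hw₂_cont.pow 2)).intervalIntegrable_of_Icc one_le_two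
    rw [intervalIntegral.integral_add i₁ i₂,
      intervalIntegral.integral_const_mul, intervalIntegral.integral_const_mul,
      intervalIntegral.integral_comp_sub_right (fun x ↦ (u₁ x - k x) ^ 2) 1]
    norm_num
  rw [hQ] at E₂
  rw [intervalIntegral.integral_zero] at E₁
  have nn : ∀ {φ : ℝ → ℝ} {l r : ℝ}, l ≤ r → 0 ≤ ∫ x in l..r, φ x ^ 2 := fun hlr ↦
    intervalIntegral.integral_nonneg hlr fun x _ ↦ sq_nonneg _
  have I₁ := nn (φ := fun x ↦ dOn 0 1 1 u₁ x - b₀) zero_le_one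
  have J₁ := nn (φ := fun x ↦ dOn 0 1 2 u₁ x - 0) zero_le_one
  have I₂ := nn (φ := fun x ↦ dOn 1 2 1 u₂ x - g₁ x) one_le_two
  have J₂ := nn (φ := fun x ↦ dOn 1 2 2 u₂ x - g₂ x) one_le_two
  obtain ⟨N, hN⟩ : ∃ N, N = (κ ^ 2 / γ + 3600) * A ^ 2 := ⟨_, rfl⟩
  have hN0 : 0 ≤ N := by rw [hN]; positivity
  have hNle : 2 * ((κ * A) ^ 2 / (2 * γ) + ε ^ 2 * (60 * A) ^ 2 / 2) ≤ (1 + ε ^ 2) * N := by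
    have e : (1 + ε ^ 2) * N - 2 * ((κ * A) ^ 2 / (2 * γ) + ε ^ 2 * (60 * A) ^ 2 / 2) =
        3600 * A ^ 2 + ε ^ 2 * (κ ^ 2 / γ * A ^ 2) := by
      rw [hN]; field_simp; ring
    have : 0 ≤ 3600 * A ^ 2 + ε ^ 2 * (κ ^ 2 / γ * A ^ 2) := by positivity
    linarith
  have sqrt_bound : ∀ {y : ℝ}, y ^ 2 ≤ 4 * (1 + 1 / s) * N →
      |y| ≤ √(4 * (1 + 1 / s) * (κ ^ 2 / γ + 3600)) * A := fun {y} hy ↦ by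
    refine abs_le_of_sq_le_sq (hy.trans_eq ?_) (by positivity)
    rw [mul_pow, Real.sq_sqrt (by positivity), hN, ← mul_assoc]
  constructor
  · intro x hx
    obtain ⟨s1, s2⟩ := h.reg₁.sq_sub_le (by norm_num) hk1 (fun x ↦ hasDerivAt_const x b₀)
      continuous_const (left_mem_Icc.2 zero_le_one) (hu0.trans hk0.symm) hu0' hx
    -- The inner `linarith` adds `E₁` and `E₂`: the fluxes at `1` and all `D / 2` integrals cancel,
    -- and `hNle` bounds the rest.
    have h1 := sqrt_bound (sq_le_of_energy_bound hε hs hN0 I₁ J₁ I₂ J₂ (by linarith) s1 s2)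
    have h2 := hkA x hx
    rw [abs_le] at h1 h2 ⊢
    constructor <;> linarith
  · intro x hx
    obtain ⟨s1, s2⟩ := h.reg₂.sq_sub_le (by norm_num) hg hg₁ hg₂ (right_mem_Icc.2 one_le_two)
      (hu2.trans e2.symm) (hu2'.trans e2'.symm) hx
    have h1 := sqrt_bound (sq_le_of_energy_bound hε hs hN0 I₂ J₂ I₁ J₁ (by linarith) s1 s2)
    have h2 := hgA x hx
    rw [abs_le] at h1 h2 ⊢
    constructor <;> linarith

end Main

/-! ### The main theorem -/

theorem lemma1 (b c d : ℝ → ℝ) (β γ : ℝ) (hcoeff : CoeffAssumptions b c d β γ) :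
    ∃ C : ℝ, 0 < C ∧
      ∀ (ε : ℝ) (_ : 0 < ε) (f Φ : ℝ → ℝ)
        (_ : MemLinfty (Ioo 0 2) f) (_ : MemLinfty (Ioo (-1) 0) Φ)
        (α₁ α₂ α₃ β₁ β₂ β₃ δ₁ δ₂ : ℝ) (u₁ u₂ : ℝ → ℝ)
        (_ : SplitSystem ε b c d f Φ u₁ u₂)
        (_ : GeneralConditions α₁ α₂ α₃ β₁ β₂ β₃ δ₁ δ₂ u₁ u₂)
        (_ : jumpAtOne 2 u₁ u₂ = 0) (_ : jumpAtOne 3 u₁ u₂ = 0),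
        MemLinfty (Ioo 0 2) (glue u₁ u₂) ∧
        linftyNorm (Ioo 0 2) (glue u₁ u₂) ≤
          C * (linftyNorm (Ioo 0 2) f + linftyNorm (Ioo (-1) 0) Φ
            + |α₁| + |α₃| + |δ₁| + |δ₂| + |β₁| + |β₃|) := by
  obtain ⟨Nb, hNb⟩ := isCompact_Icc.exists_bound_of_continuousOn hcoeff.smooth_b.continuousOn
  obtain ⟨Nc, hNc⟩ := isCompact_Icc.exists_bound_of_continuousOn hcoeff.smooth_c.continuousOn
  obtain ⟨Nd, hNd⟩ := isCompact_Icc.exists_bound_of_continuousOn hcoeff.smooth_d.continuousOn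
  refine ⟨√(4 * (1 + 1 / β ^ 2) * ((1 + Nd + 20 * Nc + 60 * Nb) ^ 2 / γ + 3600)) + 20,
    by positivity, ?_⟩
  intro ε hε f Φ hf hΦ α₁ α₂ α₃ β₁ β₂ β₃ δ₁ δ₂ u₁ u₂ hsys hbc hj2 hj3
  have nf : 0 ≤ linftyNorm (Ioo 0 2) f := linftyNorm_nonneg
  have nΦ : 0 ≤ linftyNorm (Ioo (-1) 0) Φ := linftyNorm_nonneg
  obtain ⟨A, hA⟩ : ∃ A, A = linftyNorm (Ioo 0 2) f + linftyNorm (Ioo (-1) 0) Φ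
    + |α₁| + |α₃| + |δ₁| + |δ₂| + |β₁| + |β₃| := ⟨_, rfl⟩
  rw [← hA]
  have p1 := abs_nonneg α₁
  have p2 := abs_nonneg α₃
  have p3 := abs_nonneg δ₁
  have p4 := abs_nonneg δ₂
  have p5 := abs_nonneg β₁
  have p6 := abs_nonneg β₃
  -- `a₁` and `b₁` are the value and slope at `1` of the affine lift `α₁ + β₁ x`, increased by the
  -- jumps `δ₁` and `δ₂`.
  obtain ⟨h₁, h₂⟩ := hsys.abs_solution_le (a₀ := α₁) (b₀ := β₁) (a₁ := α₁ + β₁ + δ₁) (b₁ := β₁ + δ₂)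
    (a₂ := α₃) (b₂ := β₃) (A := A) hε hcoeff.smooth_b hcoeff.beta_pos hcoeff.gamma_pos
    hcoeff.le_b
    (((hcoeff.smooth_b.of_le (by exact_mod_cast le_top)).memLinfty_deriv two_pos).ae_abs_le)
    (hcoeff.smooth_d.continuousOn.memLinfty_of_subset_Icc measurableSet_Ioo
      ((Ioo_subset_Ioo_left zero_le_one).trans Ioo_subset_Icc_self)).ae_abs_le
    hcoeff.le_c hNb hNc hNd
    (hf.ae_abs_le.mono fun x hx ↦ by linarith) (hΦ.ae_abs_le.mono fun x hx ↦ by linarith)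
    hbc.val₀ hbc.der₀ (by rw [hbc.val₁_right, hbc.val₁_left]; ring)
    (by rw [hbc.der₁_right, hbc.der₁_left]; ring) hbc.val₂ hbc.der₂ hj2 hj3 (by linarith)
    ((abs_add_three _ _ _).trans (by linarith)) ((abs_add_le _ _).trans (by linarith))
    (by linarith) (by linarith)
  have hbound : ∀ x ∈ Ioo (0 : ℝ) 2, |glue u₁ u₂ x| ≤
      (√(4 * (1 + 1 / β ^ 2) * ((1 + Nd + 20 * Nc + 60 * Nb) ^ 2 / γ + 3600)) + 20) * A := by
    intro x hx
    rcases lt_or_ge x 1 with h | h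
    · have m1 : x ∈ Ico (0 : ℝ) 1 := ⟨hx.1.le, h⟩
      have m2 : x ∉ Icc (1 : ℝ) 2 := fun m ↦ absurd m.1 (not_le.2 h)
      simpa [glue, m1, m2] using h₁ x ⟨hx.1.le, h.le⟩
    · have m1 : x ∉ Ico (0 : ℝ) 1 := fun m ↦ absurd m.2 (not_lt.2 h)
      have m2 : x ∈ Icc (1 : ℝ) 2 := ⟨h, hx.2.le⟩
      simpa [glue, m1, m2] using h₂ x m2
  have hmeas : AEStronglyMeasurable (glue u₁ u₂) (volume.restrict (Ioo 0 2)) := by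
    refine AEStronglyMeasurable.restrict (AEStronglyMeasurable.add ?_ ?_)
    · rw [aestronglyMeasurable_indicator_iff measurableSet_Ico]
      exact (hsys.reg₁.1.continuousOn.mono Ico_subset_Icc_self).aestronglyMeasurable
        measurableSet_Ico
    · rw [aestronglyMeasurable_indicator_iff measurableSet_Icc]
      exact hsys.reg₂.1.continuousOn.aestronglyMeasurable measurableSet_Icc
  refine ⟨memLinfty_of_bound measurableSet_Ioo hmeas hbound,
    linftyNorm_le_of_bound ?_ measurableSet_Ioo hbound⟩
  rw [hA]
  positivity
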